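/- For a rational number $\alpha$ let $r_\alpha$ be its denominator in lowest terms, $\Delta_\alpha=\frac12\left(1-\frac1{r_\alpha^2}\right)$ and $x_\alpha=\frac{3-\sqrt{5+8\Delta_\alpha}}2$, and for rational numbers $\alpha,\beta$ put $\alpha.\beta=\frac{\alpha+\beta}2+\frac{\Delta_\beta-\Delta_\alpha}{3+\alpha-\beta}$. Define $\varepsilon:\mathbb Z[\frac12]\to\mathbb Q$ inductively by $\varepsilon(n)=n$ for $n\in\mathbb Z$ and $\varepsilon\left(\frac{2p+1}{2^{q+1}}\right)=\varepsilon\left(\frac p{2^q}\right).\,\varepsilon\left(\frac{p+1}{2^q}\right)$ for $p\in\mathbb Z$, $q\ge 0$. Let $\mathfrak E=\varepsilon(\mathbb Z[\frac12])$ be the set of exceptional slopes (the slopes of the exceptional vector bundles on $\mathbb P^2$), let $\operatorname{ord}\alpha$ be the least $q\geq 0$ such that $\alpha=\varepsilon(p/2^q)$ for some $p\in\mathbb Z$, let $I_\alpha=(\alpha-x_\alpha,\alpha+x_\alpha)$, and let $C=\mathbb R\setminus\bigcup_{\alpha\in\mathfrak E}I_\alpha$. Put $C_{-1}=(-1,1)$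 and, for $n\ge0$, $C_n=(-1,1)\setminus\bigcup_{\alpha\in\mathfrak E,\ \operatorname{ord}\alpha\le n}I_\alpha$. Every connected component of $C_{n-1}$ contains exactly two connected components of $C_n$, a left one and a right one. The left–right sequence of a point $x\in C\cap(-1,1)$ is the infinite word $\sigma_x=(\sigma_{x,n})_{n\ge0}$ in the letters $L,R$ with $\sigma_{x,n}=L$ if $x$ lies in the left, and $\sigma_{x,n}=R$ if $x$ lies in the right, of the two components of $C_n$ contained in the component of $C_{n-1}$ containing $x$. **Theorem.** Let $x\in C\cap(0,\frac12)$ be a point whose left–right sequence $\sigma_x$ is not eventually constant. Then the regular continued fraction $x=[0;a_1,a_2,\dots]$ is infinite and the sequence $(a_i)_{i\ge1}$ is not eventually periodic. Consequently $x$ is not a quadratic irrational, i.e. not an irrational root of a quadratic polynomial with integer coefficients. -/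

import Mathlib

namespace ExceptionalSlopes

/-- The discriminant `Δ_α = (1/2) (1 - 1/r_α²)` of a rational slope `α`; here `r_α`, the smallest
positive integer with `r_α α ∈ ℤ`, is the denominator of `α`. -/
def disc (α : ℚ) : ℚ := 1 / 2 * (1 - 1 / (α.den : ℚ) ^ 2)

/-- `α . β = (α + β)/2 + (Δ_β - Δ_α)/(3 + α - β)`. -/
def dot (α β : ℚ) : ℚ := (α + β) / 2 + (disc β - disc α) / (3 + α - β)

/-- `eps q p` is `ε(p / 2^q)`. The recursion is `ε(n) = n` and
`ε((2m+1)/2^(q+1)) = ε(m/2^q) . ε((m+1)/2^q)`; the clause for even numerators says that the value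
depends only on the dyadic rational `p / 2^q`. For `p = 2m+1` the integer quotient `p / 2` is `m`. -/
def eps : ℕ → ℤ → ℚ
  | 0, p => (p : ℚ)
  | q + 1, p =>
      if Even p then eps q (p / 2)
      else dot (eps q (p / 2)) (eps q (p / 2 + 1))

/-- The set of exceptional slopes: the image of `ε`. -/
def slopes : Set ℚ := {α | ∃ (q : ℕ) (p : ℤ), α = eps q p}

/-- The order of an exceptional slope: the least `q` with `α = ε(p / 2^q)` for some integer `p`. -/
noncomputable def ord (α : ℚ) : ℕ := sInf {q : ℕ | ∃ p : ℤ, α = eps q p}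

/-- `x_α = (3 - √(5 + 8 Δ_α)) / 2`. -/
noncomputable def radius (α : ℚ) : ℝ := (3 - Real.sqrt (5 + 8 * (disc α : ℝ))) / 2

/-- The open interval `I_α = (α - x_α, α + x_α)`. -/
noncomputable def interval (α : ℚ) : Set ℝ :=
  Set.Ioo ((α : ℝ) - radius α) ((α : ℝ) + radius α)

/-- The generalized Cantor set `C`, the complement of the union of all the `I_α`. -/
noncomputable def cantorSet : Set ℝ := (⋃ α ∈ slopes, interval α)ᶜ

/-- `stage k` is what is left of `(-1, 1)` after removal of the intervals `I_α` with `ord α < k`.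
So `stage 0 = C_{-1} = (-1, 1)` and `stage (n + 1) = C_n`. -/
noncomputable def stage (k : ℕ) : Set ℝ :=
  Set.Ioo (-1) 1 \ ⋃ α ∈ {α ∈ slopes | ord α < k}, interval α

/-- The connected component of `stage k` that contains `x ∈ stage k`. (In `ℝ` connected means
order-connected: it is the set of all `y` such that the segment between `x` and `y` lies in
`stage k`.) -/
noncomputable def component (k : ℕ) (x : ℝ) : Set ℝ := Set.ordConnectedComponent (stage k) x

/-- The alphabet `{L, R}`. -/
inductive Letter where
  | L : Letter
  | R : Letter

/-- The component of `stage n` that contains `x` contains two components of `stage (n + 1)`.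
This says that `x` is in the left one: the other one, to which `y` belongs, lies to the right. -/
def InLeftPart (n : ℕ) (x : ℝ) : Prop :=
  ∃ y ∈ component n x ∩ stage (n + 1), y ∉ component (n + 1) x ∧ x < y

open Classical in
/-- The left-right sequence `σ_x` of a point `x ∈ C ∩ (-1, 1)`, with letters numbered from `0`. -/
noncomputable def leftRightSeq (x : ℝ) (n : ℕ) : Letter :=
  if InLeftPart n x then Letter.L else Letter.R

/-- The partial quotients `a₁, a₂, …` of the regular continued fraction `x = [a₀; a₁, a₂, …]`,
numbered from `0`. The value is `none` from the end on if the continued fraction is finite. -/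
noncomputable def partialQuotients (x : ℝ) (n : ℕ) : Option ℝ :=
  (GenContFract.of x).partDens.get? n

/-- An infinite word is eventually periodic. -/
def EventuallyPeriodic {S : Type*} (a : ℕ → S) : Prop :=
  ∃ p : ℕ, 0 < p ∧ ∃ N : ℕ, ∀ n ≥ N, a (n + p) = a n

/-- A quadratic irrational: an irrational root of a quadratic polynomial over `ℤ`. -/
def IsQuadraticIrrational (x : ℝ) : Prop :=
  Irrational x ∧ ∃ a b c : ℤ, a ≠ 0 ∧ (a : ℝ) * x ^ 2 + (b : ℝ) * x + (c : ℝ) = 0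

end ExceptionalSlopes

/-! Let `α < β` be neighbouring slopes of one level, with denominators `r`, `s` and distance `d = β
- α`. The invariant `1/r² + 1/s² = d(3 - d)` (`Adjacent.sum_inv_sq`) passes to both halves of the
split at `α.β`, and it gives `α.β = α + 1/(r²(3 - d))`.

A point `x` of `C` between `α` and `α.β` lies outside `I_α`, whose radius `ρ` satisfies `ρ(3 - ρ) =
1/r²`. Hence `1/3 ≤ r²(x - α) ≤ 1/(3 - d)`. If both letters occur infinitely often, both
denominators tend to infinity, so `d → 0`, and along the letters `L` one gets `r²(x - α) → 1/3`
(`exists_approximations`).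

Such approximations force `x` to be irrational. They also exclude an integral quadratic equation
`f(x) = 0`: the integers `r² f(α)` would converge to `-f'(x)/3`, which would then be an integer,
making `x` rational. By Euler's theorem the continued fraction is not eventually periodic. -/

namespace ExceptionalSlopes

/-! ### Arithmetic of neighbouring slopes -/

/-- The relations that hold between two neighbouring exceptional slopes of the same level. -/
structure Adjacent (α β : ℚ) : Prop where
  lt : α < β
  sub_le_one : β - α ≤ 1
  coprime : IsCoprime (α.den : ℤ) (β.den : ℤ)
  dvd_left : (α.den : ℤ) ∣ α.num ^ 2 + 1
  dvd_right : (β.den : ℤ) ∣ β.num ^ 2 + 1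
  sum_inv_sq : 1 / (α.den : ℚ) ^ 2 + 1 / (β.den : ℚ) ^ 2 = (β - α) * (3 - (β - α))

lemma den_pos_rat (α : ℚ) : (0 : ℚ) < α.den := by exact_mod_cast α.den_pos

lemma adjacent_intCast (n : ℤ) : Adjacent (n : ℚ) ((n : ℚ) + 1) := by
  have h : ((n : ℚ) + 1) = ((n + 1 : ℤ) : ℚ) := by push_cast; ring
  refine ⟨by linarith, by linarith, ?_, ?_, ?_, ?_⟩
  · simp [isCoprime_one_left]
  · simp
  · rw [h]; simp only [Rat.den_intCast]; simp
  · rw [h]; simp only [Rat.den_intCast]; push_cast; ring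

namespace Adjacent

variable {α β : ℚ}

lemma three_sub_pos (h : Adjacent α β) : 0 < 3 - (β - α) := by linarith [h.sub_le_one]

/-- Eliminating `1/s²` by `sum_inv_sq` turns `Δ_β - Δ_α` into `1/r² - d(3 - d)/2`; its second term
moves the midpoint back to `α`. -/
lemma dot_eq_left (h : Adjacent α β) :
    dot α β = α + 1 / ((α.den : ℚ) ^ 2 * (3 - (β - α))) := by
  have h3 := h.three_sub_pos
  have e : 3 + α - β = 3 - (β - α) := by ring
  have key := h.sum_inv_sq
  have : 1 / ((α.den : ℚ) ^ 2 * (3 - (β - α))) = (1 / (α.den : ℚ) ^ 2) / (3 - (β - α)) := by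
    rw [div_div]
  rw [this, dot, disc, disc, e]
  have hs : 1 / (β.den : ℚ) ^ 2 = (β - α) * (3 - (β - α)) - 1 / (α.den : ℚ) ^ 2 := by
    linarith
  rw [hs]
  field_simp
  ring

lemma dot_eq_right (h : Adjacent α β) :
    dot α β = β - 1 / ((β.den : ℚ) ^ 2 * (3 - (β - α))) := by
  have h3 := h.three_sub_pos
  have e : 3 + α - β = 3 - (β - α) := by ring
  have key := h.sum_inv_sq
  have : 1 / ((β.den : ℚ) ^ 2 * (3 - (β - α))) = (1 / (β.den : ℚ) ^ 2) / (3 - (β - α)) := by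
    rw [div_div]
  rw [this, dot, disc, disc, e]
  have hs : 1 / (β.den : ℚ) ^ 2 = (β - α) * (3 - (β - α)) - 1 / (α.den : ℚ) ^ 2 := by
    linarith
  rw [hs]
  field_simp
  ring

lemma lt_dot (h : Adjacent α β) : α < dot α β := by
  have h3 := h.three_sub_pos
  have := den_pos_rat α
  rw [h.dot_eq_left]
  have : 0 < 1 / ((α.den : ℚ) ^ 2 * (3 - (β - α))) := by positivity
  linarith

lemma dot_lt (h : Adjacent α β) : dot α β < β := by
  have h3 := h.three_sub_pos
  have := den_pos_rat β
  rw [h.dot_eq_right]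
  have : 0 < 1 / ((β.den : ℚ) ^ 2 * (3 - (β - α))) := by positivity
  linarith

/-- The arithmetic of `dot α β`: its denominator is `r s (3 - (β - α))`, it is coprime to the
denominators `r` and `s` of `α` and `β`, and it divides the square of the numerator plus one. -/
lemma dot_arith (h : Adjacent α β) :
    ((dot α β).den : ℚ) = α.den * β.den * (3 - (β - α)) ∧
    IsCoprime (α.den : ℤ) ((dot α β).den : ℤ) ∧ IsCoprime ((dot α β).den : ℤ) (β.den : ℤ) ∧
    ((dot α β).den : ℤ) ∣ (dot α β).num ^ 2 + 1 := by
  have h3 := h.three_sub_pos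
  have hr := den_pos_rat α
  have hs := den_pos_rat β
  have hcop := h.coprime
  have hdot := h.dot_eq_left
  have hsum := h.sum_inv_sq
  have hα : α = α.num / α.den := (Rat.num_div_den α).symm
  have hβ : β = β.num / β.den := (Rat.num_div_den β).symm
  have har : IsCoprime α.num (α.den : ℤ) := Rat.isCoprime_num_den α
  have hbs : IsCoprime β.num (β.den : ℤ) := Rat.isCoprime_num_den β
  obtain ⟨c, hc⟩ := h.dvd_left
  set a := α.num
  set b := β.num
  set r : ℤ := (α.den : ℤ) with hrdef
  set s : ℤ := (β.den : ℤ) with hsdef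
  have hr' : (α.den : ℚ) = (r : ℚ) := by simp [hrdef]
  have hs' : (β.den : ℚ) = (s : ℚ) := by simp [hsdef]
  rw [hr'] at hr hα hdot hsum
  rw [hs'] at hs hβ hsum
  rw [hr', hs']
  obtain ⟨q, hq⟩ : ∃ q : ℤ, q = 3 * r * s + a * s - b * r := ⟨_, rfl⟩
  have hq3 : (q : ℚ) = r * s * (3 - (β - α)) := by
    rw [hα, hβ, hq]; push_cast; field_simp; ring
  have hqpos : (0 : ℚ) < q := by rw [hq3]; positivity
  -- `m/q` will be `α.β = a/r + s/(rq)`. Since `q ≡ as` mod `r`, integrality of `m` amounts to `r ∣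
  -- s(a² + 1)`.
  obtain ⟨m, hm⟩ : ∃ m : ℤ, m * r = a * q + s :=
    ⟨3 * a * s - a * b + s * c, by rw [hq]; linear_combination (-s) * hc⟩
  have hmk : r ^ 2 + s ^ 2 = (b * r - a * s) * q := by
    have : (r : ℚ) ^ 2 + (s : ℚ) ^ 2 = (b * r - a * s) * q := by
      have e : (b * r - a * s : ℚ) = r * s * (β - α) := by rw [hα, hβ]; field_simp
      rw [e, hq3]
      have : (r : ℚ) ^ 2 + (s : ℚ) ^ 2 = (r * s) ^ 2 * (1 / (r : ℚ) ^ 2 + 1 / (s : ℚ) ^ 2) := by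
        field_simp; ring
      rw [this, hsum]; ring
    exact_mod_cast this
  have hrq : IsCoprime r q := by
    have : q = a * s + r * (3 * s - b) := by rw [hq]; ring
    rw [this]
    exact (har.symm.mul_right hcop).add_mul_left_right _
  have hqs : IsCoprime q s := by
    have : q = -(b * r) + s * (3 * r + a) := by rw [hq]; ring
    rw [this]
    exact IsCoprime.add_mul_left_left ((hbs.mul_left hcop).neg_left) _
  have hmq : IsCoprime m q := by
    have : IsCoprime (m * r) q := by
      rw [hm, add_comm, mul_comm a q]
      exact hqs.symm.add_mul_left_left _
    exact this.of_mul_left_left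
  have hdvd : q ∣ m ^ 2 + 1 := by
    -- `r²(m² + 1) = (aq + s)² + r²`, and `q` divides `r² + s²` by `hmk`; the factor `r²` is prime
    -- to `q`.
    refine (hrq.symm.pow_right (n := 2)).dvd_of_dvd_mul_left (?_ : q ∣ r ^ 2 * (m ^ 2 + 1))
    refine ⟨a ^ 2 * q + 2 * a * s + (b * r - a * s), ?_⟩
    linear_combination (m * r + a * q + s) * hm + hmk
  have heq : dot α β = (m : ℚ) / (q : ℚ) := by
    have hmQ : (m : ℚ) * r = a * q + s := by exact_mod_cast hm
    have e : (3 - (β - α)) = q / (r * s) := by rw [hq3]; field_simp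
    rw [hdot, e]
    have e2 : (m : ℚ) = (a * q + s) / r := by rw [← hmQ]; field_simp
    rw [e2, hα]
    field_simp
  have hqz : 0 < q := by exact_mod_cast hqpos
  have hcop' : Nat.Coprime m.natAbs q.natAbs := Int.isCoprime_iff_nat_coprime.mp hmq
  have hden : ((dot α β).den : ℤ) = q := by rw [heq]; exact Rat.den_div_eq_of_coprime hqz hcop'
  have hnum : (dot α β).num = m := by rw [heq]; exact Rat.num_div_eq_of_coprime hqz hcop'
  refine ⟨?_, ?_, ?_, ?_⟩
  · rw [← hq3, ← hden]; simp
  · rw [hden]; exact hrq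
  · rw [hden]; exact hqs
  · rw [hden, hnum]; exact hdvd

lemma den_dot (h : Adjacent α β) :
    ((dot α β).den : ℚ) = α.den * β.den * (3 - (β - α)) := h.dot_arith.1

lemma left (h : Adjacent α β) : Adjacent α (dot α β) := by
  have h3 := h.three_sub_pos
  have hr := den_pos_rat α
  have hs := den_pos_rat β
  refine ⟨h.lt_dot, by linarith [h.dot_lt, h.sub_le_one], h.dot_arith.2.1, h.dvd_left,
    h.dot_arith.2.2.2, ?_⟩
  have e : dot α β - α = 1 / ((α.den : ℚ) ^ 2 * (3 - (β - α))) := by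
    rw [h.dot_eq_left]; ring
  rw [e, h.den_dot]
  have key := h.sum_inv_sq
  generalize β - α = d at *
  field_simp at key ⊢
  linear_combination key

lemma right (h : Adjacent α β) : Adjacent (dot α β) β := by
  have h3 := h.three_sub_pos
  have hr := den_pos_rat α
  have hs := den_pos_rat β
  refine ⟨h.dot_lt, by linarith [h.lt_dot, h.sub_le_one], h.dot_arith.2.2.1, h.dot_arith.2.2.2,
    h.dvd_right, ?_⟩
  have e : β - dot α β = 1 / ((β.den : ℚ) ^ 2 * (3 - (β - α))) := by
    rw [h.dot_eq_right]; ring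
  rw [e, h.den_dot]
  have key := h.sum_inv_sq
  generalize β - α = d at *
  field_simp at key ⊢
  linear_combination key

lemma two_mul_den_left_le (h : Adjacent α β) : 2 * α.den ≤ (dot α β).den := by
  have hd := h.den_dot
  have hr := den_pos_rat α
  have hs : (1 : ℚ) ≤ β.den := by exact_mod_cast β.den_pos
  have h3 : 2 ≤ 3 - (β - α) := by linarith [h.sub_le_one]
  have : (2 * α.den : ℚ) ≤ (dot α β).den := by
    rw [hd]; nlinarith [mul_le_mul hs h3 (by norm_num) (by linarith)]
  exact_mod_cast this

lemma two_mul_den_right_le (h : Adjacent α β) : 2 * β.den ≤ (dot α β).den := by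
  have hd := h.den_dot
  have hr : (1 : ℚ) ≤ α.den := by exact_mod_cast α.den_pos
  have hs := den_pos_rat β
  have h3 : 2 ≤ 3 - (β - α) := by linarith [h.sub_le_one]
  have : (2 * β.den : ℚ) ≤ (dot α β).den := by
    rw [hd]; nlinarith [mul_le_mul hr h3 (by norm_num) (by linarith)]
  exact_mod_cast this

end Adjacent

lemma eps_succ_two_mul (q : ℕ) (p : ℤ) : eps (q + 1) (2 * p) = eps q p := by
  have h : (2 * p) / 2 = p := by omega
  simp [eps, h]

lemma eps_succ_two_mul_add_one (q : ℕ) (p : ℤ) :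
    eps (q + 1) (2 * p + 1) = dot (eps q p) (eps q (p + 1)) := by
  have h : (2 * p + 1) / 2 = p := by omega
  have h' : ¬ Even (2 * p + 1) := by simp
  simp [eps, h, h']

lemma adjacent_eps (q : ℕ) (p : ℤ) : Adjacent (eps q p) (eps q (p + 1)) := by
  induction q generalizing p with
  | zero => simpa [eps] using adjacent_intCast p
  | succ q ih =>
    rcases Int.even_or_odd' p with ⟨k, rfl | rfl⟩
    · rw [eps_succ_two_mul, eps_succ_two_mul_add_one]
      exact (ih k).left
    · rw [eps_succ_two_mul_add_one, show 2 * k + 1 + 1 = 2 * (k + 1) by ring, eps_succ_two_mul]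
      exact (ih k).right

lemma eps_add (q k : ℕ) (p : ℤ) : eps (q + k) (2 ^ k * p) = eps q p := by
  induction k with
  | zero => simp
  | succ k ih => rw [← ih, ← add_assoc, pow_succ', mul_assoc, eps_succ_two_mul]

/-- A slope of order at most `m` occurs at level `m`. -/
lemma exists_eps_of_ord_le {α : ℚ} (hα : α ∈ slopes) {m : ℕ} (h : ord α ≤ m) :
    ∃ p : ℤ, α = eps m p := by
  obtain ⟨p, hp⟩ : ord α ∈ {q : ℕ | ∃ p : ℤ, α = eps q p} := Nat.sInf_mem hα
  obtain ⟨k, rfl⟩ := Nat.exists_eq_add_of_le h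
  exact ⟨_, hp.trans (eps_add _ k p).symm⟩

lemma ord_eps_le (m : ℕ) (p : ℤ) : ord (eps m p) ≤ m := Nat.sInf_le ⟨p, rfl⟩

lemma eps_mem_slopes (m : ℕ) (p : ℤ) : eps m p ∈ slopes := ⟨m, p, rfl⟩

end ExceptionalSlopes

/-! ### Continued fractions and Euler's theorem -/

namespace ExceptionalSlopes
open Filter Topology

/-- The map `v ↦ 1 / fract v`, which drops the leading term of a continued fraction. -/
noncomputable def gauss (v : ℝ) : ℝ := (Int.fract v)⁻¹

lemma fract_ne_zero_of_irrational {v : ℝ} (hv : Irrational v) : Int.fract v ≠ 0 := by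
  intro h
  rw [Int.fract_eq_iff] at h
  obtain ⟨_, _, z, hz⟩ := h
  exact hv ⟨z, by simpa using hz.symm⟩

lemma irrational_gauss {v : ℝ} (hv : Irrational v) : Irrational (gauss v) := by
  have : Irrational (Int.fract v) := by
    rw [Int.fract]; exact hv.sub_intCast _
  exact irrational_inv_iff.mpr this

lemma irrational_iterate_gauss {v : ℝ} (hv : Irrational v) (n : ℕ) :
    Irrational (gauss^[n] v) := by
  induction n with
  | zero => exact hv
  | succ n ih => rw [Function.iterate_succ_apply']; exact irrational_gauss ih

lemma eq_floor_add_inv_gauss (v : ℝ) : v = ⌊v⌋ + (gauss v)⁻¹ := by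
  rw [gauss, inv_inv, Int.floor_add_fract]

lemma one_le_floor_gauss {v : ℝ} (hv : Irrational v) : 1 ≤ ⌊gauss v⌋ := by
  rw [Int.le_floor, gauss]
  have h0 := (Int.fract_nonneg v).lt_of_ne (fract_ne_zero_of_irrational hv).symm
  simpa using (one_le_inv₀ h0).mpr (Int.fract_lt_one v).le

lemma of_s_get?_of_irrational {v : ℝ} (hv : Irrational v) (n : ℕ) :
    (GenContFract.of v).s.get? n = some ⟨1, (⌊gauss^[n + 1] v⌋ : ℝ)⟩ := by
  induction n generalizing v with
  | zero => exact GenContFract.of_s_head (fract_ne_zero_of_irrational hv)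
  | succ n ih =>
    rw [GenContFract.of_s_succ, Function.iterate_succ_apply]
    exact ih (irrational_gauss hv)

lemma partialQuotients_of_irrational {v : ℝ} (hv : Irrational v) (n : ℕ) :
    partialQuotients v n = some (⌊gauss^[n + 1] v⌋ : ℝ) := by
  simp [partialQuotients, GenContFract.partDens, of_s_get?_of_irrational hv]

lemma convs_eq_of_floor_eq {u v : ℝ} (h : ∀ n, ⌊gauss^[n] u⌋ = ⌊gauss^[n] v⌋) (n : ℕ) :
    (GenContFract.of u).convs n = (GenContFract.of v).convs n := by
  induction n generalizing u v with
  | zero =>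
    have h0 := h 0
    simp only [Function.iterate_zero, id_eq] at h0
    simp [GenContFract.zeroth_conv_eq_h, GenContFract.of_h_eq_floor, h0]
  | succ n ih =>
    have h0 := h 0
    simp only [Function.iterate_zero, id_eq] at h0
    have h1 := ih (u := gauss u) (v := gauss v) fun n => by
      simpa only [Function.iterate_succ_apply] using h (n + 1)
    rw [GenContFract.convs_succ, GenContFract.convs_succ, h0]
    rw [gauss, gauss] at h1
    rw [h1]

/-- A real number is determined by its continued fraction. -/
lemma eq_of_floor_gauss_eq {u v : ℝ} (h : ∀ n, ⌊gauss^[n] u⌋ = ⌊gauss^[n] v⌋) : u = v := by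
  have hu := GenContFract.of_convergence u
  have hv := GenContFract.of_convergence v
  rw [funext (convs_eq_of_floor_eq h)] at hu
  exact tendsto_nhds_unique hu hv

/-- The complete quotients are related by Möbius transformations with integer coefficients. -/
lemma exists_moebius {v : ℝ} (hv : Irrational v) (k : ℕ) :
    ∃ A B C D : ℤ, 0 < C ∧ 0 ≤ D ∧
      v * (C * gauss^[k + 1] v + D) = A * gauss^[k + 1] v + B := by
  induction k with
  | zero =>
    refine ⟨⌊v⌋, 1, 1, 0, one_pos, le_rfl, ?_⟩
    have h := eq_floor_add_inv_gauss v
    have h0 : gauss v ≠ 0 := (irrational_gauss hv).ne_zero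
    simp only [zero_add, Function.iterate_one]
    generalize gauss v = g at *
    nth_rw 1 [h]
    field_simp
    push_cast
    ring
  | succ k ih =>
    obtain ⟨A, B, C, D, hC, hD, h⟩ := ih
    set w := gauss^[k + 1] v with hw
    have hwi : Irrational w := irrational_iterate_gauss hv _
    have e : gauss^[k + 1 + 1] v = gauss w := Function.iterate_succ_apply' _ _ _
    have h1 : 1 ≤ ⌊w⌋ := by
      rw [hw, Function.iterate_succ_apply']
      exact one_le_floor_gauss (irrational_iterate_gauss hv k)
    have h0 : gauss w ≠ 0 := (irrational_gauss hwi).ne_zero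
    have hw2 := eq_floor_add_inv_gauss w
    refine ⟨A * ⌊w⌋ + B, A, C * ⌊w⌋ + D, C, by positivity, hC.le, ?_⟩
    rw [e]
    have hg : w * gauss w = ⌊w⌋ * gauss w + 1 := by
      nth_rw 1 [hw2]
      field_simp
    push_cast
    linear_combination gauss w * h + (A - v * C) * hg

lemma isQuadraticIrrational_of_gauss {v : ℝ} (hv : Irrational v)
    (h : IsQuadraticIrrational (gauss v)) : IsQuadraticIrrational v := by
  obtain ⟨hg, a, b, c, ha, e⟩ := h
  have hc : c ≠ 0 := by
    rintro rfl
    refine hg ⟨-b / a, ?_⟩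
    have ha' : (a : ℝ) ≠ 0 := by exact_mod_cast ha
    have : (a : ℝ) * gauss v + b = 0 :=
      (mul_eq_zero.mp (by push_cast at e; linear_combination e :
        gauss v * ((a : ℝ) * gauss v + b) = 0)).resolve_left hg.ne_zero
    push_cast
    field_simp
    linear_combination -this
  refine ⟨hv, c, b - 2 * c * ⌊v⌋, a - b * ⌊v⌋ + c * ⌊v⌋ ^ 2, hc, ?_⟩
  have hv2 : (v - ⌊v⌋) * gauss v = 1 := by
    have := eq_floor_add_inv_gauss v
    have h0 := hg.ne_zero
    nth_rw 1 [this]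
    field_simp
    ring
  push_cast
  set t := v - (⌊v⌋ : ℝ)
  linear_combination t ^ 2 * e - (a * (t * gauss v + 1) + b * t) * hv2

lemma isQuadraticIrrational_of_iterate_gauss {v : ℝ} (hv : Irrational v) (n : ℕ)
    (h : IsQuadraticIrrational (gauss^[n] v)) : IsQuadraticIrrational v := by
  induction n with
  | zero => exact h
  | succ n ih =>
    rw [Function.iterate_succ_apply'] at h
    exact ih (isQuadraticIrrational_of_gauss (irrational_iterate_gauss hv n) h)

/-- Euler: an irrational number with an eventually periodic continued fraction is a quadratic
irrational. -/
theorem isQuadraticIrrational_of_eventuallyPeriodic {v : ℝ} (hv : Irrational v)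
    (h : EventuallyPeriodic (partialQuotients v)) : IsQuadraticIrrational v := by
  obtain ⟨p, hp, N, hN⟩ := h
  -- The entry numbered `n` is the floor of the complete quotient numbered `n + 1`, hence the shift
  -- to `N + 1`.
  have hy : gauss^[p + (N + 1)] v = gauss^[N + 1] v := by
    refine eq_of_floor_gauss_eq fun n => ?_
    have := hN (n + N) (by omega)
    rw [partialQuotients_of_irrational hv, partialQuotients_of_irrational hv] at this
    rw [← Function.iterate_add_apply, ← Function.iterate_add_apply]
    have e : n + (p + (N + 1)) = n + N + p + 1 := by ring
    rw [e, ← add_assoc n N 1]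
    simpa using this
  refine isQuadraticIrrational_of_iterate_gauss hv (N + 1) ?_
  rw [Function.iterate_add_apply] at hy
  have hyi := irrational_iterate_gauss hv (N + 1)
  set y := gauss^[N + 1] v
  obtain ⟨k, rfl⟩ := Nat.exists_eq_succ_of_ne_zero hp.ne'
  obtain ⟨A, B, C, D, hC, -, e⟩ := exists_moebius hyi k
  -- Now `y` is a fixed point of a Möbius map with `C > 0`, so its equation is genuinely quadratic.
  rw [← Nat.succ_eq_add_one, hy] at e
  refine ⟨hyi, C, D - A, -B, hC.ne', ?_⟩
  push_cast
  linear_combination e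

end ExceptionalSlopes

/-! ### The intervals, the gaps and the left-right sequence -/

namespace ExceptionalSlopes
open Filter Topology

lemma radius_eq (α : ℚ) : radius α = (3 - Real.sqrt (9 - 4 / (α.den : ℝ) ^ 2)) / 2 := by
  rw [radius, disc]; push_cast; congr 3; ring

lemma inv_den_sq_le_one (α : ℚ) : 1 / (α.den : ℝ) ^ 2 ≤ 1 := by
  have : (1 : ℝ) ≤ α.den := by exact_mod_cast α.den_pos
  rw [div_le_one (by positivity)]
  nlinarith

lemma inv_den_sq_pos (α : ℚ) : 0 < 1 / (α.den : ℝ) ^ 2 := by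
  have : (0 : ℝ) < α.den := by exact_mod_cast α.den_pos
  positivity

lemma radius_mul (α : ℚ) : radius α * (3 - radius α) = 1 / (α.den : ℝ) ^ 2 := by
  have h1 := inv_den_sq_le_one α
  have hs : Real.sqrt (9 - 4 / (α.den : ℝ) ^ 2) ^ 2 = 9 - 4 / (α.den : ℝ) ^ 2 :=
    Real.sq_sqrt (by rw [show (4 : ℝ) / (α.den : ℝ) ^ 2 = 4 * (1 / (α.den : ℝ) ^ 2) by ring]
                     linarith)
  rw [radius_eq]
  linear_combination (-1 / 4) * hs

lemma radius_lt (α : ℚ) : radius α < 1 / 2 := by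
  have h1 := inv_den_sq_le_one α
  have : 2 < Real.sqrt (9 - 4 / (α.den : ℝ) ^ 2) := by
    apply Real.lt_sqrt_of_sq_lt
    rw [show (4 : ℝ) / (α.den : ℝ) ^ 2 = 4 * (1 / (α.den : ℝ) ^ 2) by ring]
    linarith
  rw [radius_eq]; linarith

lemma radius_pos (α : ℚ) : 0 < radius α := by
  have h := radius_mul α
  have h2 := radius_lt α
  have h3 := inv_den_sq_pos α
  by_contra! h0
  nlinarith [mul_nonneg (neg_nonneg.mpr h0) (by linarith : 0 ≤ 3 - radius α)]

lemma mem_interval_self (α : ℚ) : (α : ℝ) ∈ interval α := by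
  have := radius_pos α
  constructor <;> linarith

/-- With `f(t) = t(3 - t)`, the invariant reads `f(d) = f(ρ) + f(ρ')` for the two radii, and this
exceeds `f(ρ + ρ')` by `2ρρ'`. As `f` increases on `[0, 1]`, it follows that `d > ρ + ρ'`. -/
lemma Adjacent.add_radius_lt {α β : ℚ} (h : Adjacent α β) :
    (α : ℝ) + radius α < β - radius β := by
  have key : 1 / (α.den : ℝ) ^ 2 + 1 / (β.den : ℝ) ^ 2 = (β - α) * (3 - (β - α)) := by
    have := congrArg (Rat.cast : ℚ → ℝ) h.sum_inv_sq
    push_cast at this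
    exact this
  rw [← radius_mul, ← radius_mul] at key
  have hα := radius_pos α
  have hβ := radius_pos β
  have hα' := radius_lt α
  have hβ' := radius_lt β
  have hle : (β : ℝ) - α ≤ 1 := by exact_mod_cast h.sub_le_one
  by_contra! hc
  nlinarith [mul_pos hα hβ,
    mul_nonneg (by linarith : 0 ≤ radius α + radius β - (β - α))
      (by linarith : 0 ≤ 3 - (radius α + radius β) - (β - α))]

/-- The part of `ℝ` between the intervals around two neighbouring slopes of level `m`. -/
noncomputable def gap (m : ℕ) (p : ℤ) : Set ℝ :=
  Set.Icc ((eps m p : ℝ) + radius (eps m p)) ((eps m (p + 1) : ℝ) - radius (eps m (p + 1)))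

lemma strictMono_eps_add_radius (m : ℕ) :
    StrictMono fun p : ℤ => (eps m p : ℝ) + radius (eps m p) :=
  strictMono_int_of_lt_succ fun p =>
    (adjacent_eps m p).add_radius_lt.trans (by linarith [radius_pos (eps m (p + 1))])

lemma strictMono_eps_sub_radius (m : ℕ) :
    StrictMono fun p : ℤ => (eps m p : ℝ) - radius (eps m p) :=
  strictMono_int_of_lt_succ fun p =>
    lt_trans (by linarith [radius_pos (eps m p)]) (adjacent_eps m p).add_radius_lt

lemma notMem_interval_of_mem_gap {m : ℕ} {p : ℤ} {z : ℝ} (hz : z ∈ gap m p) (k : ℤ) :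
    z ∉ interval (eps m k) := by
  rintro ⟨h1, h2⟩
  rcases le_or_gt k p with hk | hk
  · have := (strictMono_eps_add_radius m).monotone hk
    linarith [hz.1]
  · have := (strictMono_eps_sub_radius m).monotone (Int.add_one_le_of_lt hk)
    linarith [hz.2]

lemma mem_stage_of_mem_gap {m : ℕ} {p : ℤ} {z : ℝ} (hz : z ∈ gap m p)
    (h0 : 0 ≤ eps m p) (h1 : eps m (p + 1) ≤ 1) : z ∈ stage (m + 1) := by
  have h0' : (0 : ℝ) ≤ eps m p := by exact_mod_cast h0
  have h1' : (eps m (p + 1) : ℝ) ≤ 1 := by exact_mod_cast h1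
  refine ⟨⟨by linarith [hz.1, radius_pos (eps m p)],
    by linarith [hz.2, radius_pos (eps m (p + 1))]⟩, ?_⟩
  simp only [Set.mem_iUnion, not_exists]
  rintro α ⟨hα, hlt⟩ hmem
  obtain ⟨k, rfl⟩ := exists_eps_of_ord_le hα (Nat.lt_succ_iff.mp hlt)
  exact notMem_interval_of_mem_gap hz k hmem

lemma notMem_interval_of_mem_stage {m : ℕ} {z : ℝ} (hz : z ∈ stage (m + 1)) (p : ℤ) :
    z ∉ interval (eps m p) := by
  intro h
  refine hz.2 ?_
  simp only [Set.mem_iUnion]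
  exact ⟨_, ⟨eps_mem_slopes m p, Nat.lt_succ_of_le (ord_eps_le m p)⟩, h⟩

/-- The numerator `p` with `x` between `eps q p` and `eps q (p + 1)`, for `x` in `(0, 1)`. -/
noncomputable def index (x : ℝ) : ℕ → ℤ
  | 0 => 0
  | q + 1 => if x < dot (eps q (index x q)) (eps q (index x q + 1)) then 2 * index x q
      else 2 * index x q + 1

/-- The largest slope of level `q` below `x`. -/
noncomputable def lower (x : ℝ) (q : ℕ) : ℚ := eps q (index x q)

/-- The smallest slope of level `q` above `x`. -/
noncomputable def upper (x : ℝ) (q : ℕ) : ℚ := eps q (index x q + 1)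

/-- The slope of level `q + 1` that decides between left and right. -/
noncomputable def mid (x : ℝ) (q : ℕ) : ℚ := dot (lower x q) (upper x q)

lemma adjacent_lower_upper (x : ℝ) (q : ℕ) : Adjacent (lower x q) (upper x q) :=
  adjacent_eps q _

lemma index_succ_of_lt {x : ℝ} {q : ℕ} (h : x < mid x q) :
    index x (q + 1) = 2 * index x q := if_pos h

lemma index_succ_of_not_lt {x : ℝ} {q : ℕ} (h : ¬ x < mid x q) :
    index x (q + 1) = 2 * index x q + 1 := if_neg h

lemma mid_eq_eps (x : ℝ) (q : ℕ) : mid x q = eps (q + 1) (2 * index x q + 1) :=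
  (eps_succ_two_mul_add_one _ _).symm

lemma lower_succ_of_lt {x : ℝ} {q : ℕ} (h : x < mid x q) : lower x (q + 1) = lower x q := by
  rw [lower, index_succ_of_lt h, eps_succ_two_mul, lower]

lemma upper_succ_of_lt {x : ℝ} {q : ℕ} (h : x < mid x q) : upper x (q + 1) = mid x q := by
  rw [upper, index_succ_of_lt h, mid_eq_eps]

lemma lower_succ_of_not_lt {x : ℝ} {q : ℕ} (h : ¬ x < mid x q) :
    lower x (q + 1) = mid x q := by
  rw [lower, index_succ_of_not_lt h, mid_eq_eps]

lemma upper_succ_of_not_lt {x : ℝ} {q : ℕ} (h : ¬ x < mid x q) :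
    upper x (q + 1) = upper x q := by
  rw [upper, index_succ_of_not_lt h, add_assoc, one_add_one_eq_two,
    show 2 * index x q + 2 = 2 * (index x q + 1) by ring, eps_succ_two_mul, upper]

lemma lower_nonneg_and_upper_le_one (x : ℝ) (q : ℕ) : 0 ≤ lower x q ∧ upper x q ≤ 1 := by
  induction q with
  | zero => simp [lower, upper, index, eps]
  | succ q ih =>
    have h := adjacent_lower_upper x q
    have h1 := h.lt_dot
    have h2 := h.dot_lt
    by_cases hx : x < mid x q
    · rw [lower_succ_of_lt hx, upper_succ_of_lt hx]
      exact ⟨ih.1, h2.le.trans ih.2⟩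
    · rw [lower_succ_of_not_lt hx, upper_succ_of_not_lt hx]
      exact ⟨ih.1.trans h1.le, ih.2⟩

lemma notMem_interval_of_mem_cantorSet {x : ℝ} (hx : x ∈ cantorSet) {α : ℚ} (hα : α ∈ slopes) :
    x ∉ interval α := by
  intro h
  exact hx (Set.mem_biUnion hα h)

lemma add_radius_le {α : ℚ} {x : ℝ} (h : x ∉ interval α) (hlt : (α : ℝ) ≤ x) :
    α + radius α ≤ x := by
  by_contra! hc
  exact h ⟨by linarith [radius_pos α], hc⟩

lemma le_sub_radius {α : ℚ} {x : ℝ} (h : x ∉ interval α) (hlt : x ≤ (α : ℝ)) :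
    x ≤ α - radius α := by
  by_contra! hc
  exact h ⟨hc, by linarith [radius_pos α]⟩

lemma lower_lt_and_lt_upper {x : ℝ} (hx : x ∈ Set.Ioo (0 : ℝ) 1) (hC : x ∈ cantorSet) (q : ℕ) :
    (lower x q : ℝ) < x ∧ x < upper x q := by
  induction q with
  | zero => simpa [lower, upper, index, eps] using hx
  | succ q ih =>
    by_cases h : x < mid x q
    · rw [lower_succ_of_lt h, upper_succ_of_lt h]
      exact ⟨ih.1, h⟩
    · rw [lower_succ_of_not_lt h, upper_succ_of_not_lt h]
      have hm : mid x q ∈ slopes := by rw [mid_eq_eps]; exact eps_mem_slopes _ _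
      exact ⟨by linarith [add_radius_le (notMem_interval_of_mem_cantorSet hC hm) (not_lt.mp h),
        radius_pos (mid x q)], ih.2⟩

lemma mem_gap_index {x : ℝ} (hx : x ∈ Set.Ioo (0 : ℝ) 1) (hC : x ∈ cantorSet) (q : ℕ) :
    x ∈ gap q (index x q) := by
  have h := lower_lt_and_lt_upper hx hC q
  exact ⟨add_radius_le (notMem_interval_of_mem_cantorSet hC (eps_mem_slopes _ _)) h.1.le,
    le_sub_radius (notMem_interval_of_mem_cantorSet hC (eps_mem_slopes _ _)) h.2.le⟩

lemma gap_index_subset_stage (x : ℝ) (q : ℕ) : gap q (index x q) ⊆ stage (q + 1) :=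
  fun _ hz => mem_stage_of_mem_gap hz (lower_nonneg_and_upper_le_one x q).1
    (lower_nonneg_and_upper_le_one x q).2

/-- The letters of the left-right sequence compare `x` with the slopes `mid x q`. -/
lemma inLeftPart_iff {x : ℝ} (hx : x ∈ Set.Ioo (0 : ℝ) 1) (hC : x ∈ cantorSet) (q : ℕ) :
    InLeftPart (q + 1) x ↔ x < mid x q := by
  have hadj := adjacent_lower_upper x q
  have hxg := mem_gap_index hx hC q
  constructor
  · rintro ⟨y, ⟨hy1, hy2⟩, hy3, hxy⟩
    by_contra hlt
    -- To the right of `mid`, a path from `x` to `y` in the old component cannot cross `upper x q`,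
    -- so it stays in one gap of level `q + 1`.
    refine hy3 ?_
    change y ∈ Set.ordConnectedComponent _ _ at hy1
    rw [Set.mem_ordConnectedComponent, Set.uIcc_of_le hxy.le] at hy1
    rw [component, Set.mem_ordConnectedComponent, Set.uIcc_of_le hxy.le]
    intro z hz
    have hgi := mem_gap_index hx hC (q + 1)
    refine gap_index_subset_stage x (q + 1) ⟨hgi.1.trans hz.1, ?_⟩
    have hu : eps (q + 1) (index x (q + 1) + 1) = upper x q := upper_succ_of_not_lt hlt
    have hnot : ∀ w ∈ Set.Icc x y, w ∉ interval (upper x q) := fun w hw =>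
      notMem_interval_of_mem_stage (hy1 hw) _
    rw [hu]
    refine le_sub_radius (hnot z hz) ?_
    by_contra! hc
    exact hnot _ ⟨(lower_lt_and_lt_upper hx hC q).2.le, hc.le.trans hz.2⟩ (mem_interval_self _)
  · intro hlt
    have hm : mid x q = eps (q + 1) (2 * index x q + 1) := mid_eq_eps x q
    have hu : upper x q = eps (q + 1) (2 * index x q + 1 + 1) := by
      rw [add_assoc, one_add_one_eq_two, show 2 * index x q + 2 = 2 * (index x q + 1) by ring,
        eps_succ_two_mul, upper]
    have hxy : x < mid x q + radius (mid x q) := by linarith [radius_pos (mid x q)]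
    have hr := hadj.right.add_radius_lt
    change (mid x q : ℝ) + radius (mid x q) < _ at hr
    -- The witness is the right end of the interval removed around `mid x q`; `mid x q` itself
    -- separates it from `x`.
    refine ⟨(mid x q : ℝ) + radius (mid x q), ⟨?_, ?_⟩, ?_, hxy⟩
    · rw [component, Set.mem_ordConnectedComponent, Set.uIcc_of_le hxy.le]
      exact fun z hz => gap_index_subset_stage x q ⟨hxg.1.trans hz.1, hz.2.trans hr.le⟩
    · refine mem_stage_of_mem_gap (p := 2 * index x q + 1) ⟨?_, ?_⟩ ?_ ?_
      · rw [← hm]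
      · rw [← hu]; exact hr.le
      · rw [← hm]; exact (lower_nonneg_and_upper_le_one x q).1.trans hadj.lt_dot.le
      · rw [← hu]; exact (lower_nonneg_and_upper_le_one x q).2
    · rw [component, Set.mem_ordConnectedComponent, Set.uIcc_of_le hxy.le]
      intro hsub
      have := hsub (a := (mid x q : ℝ)) ⟨hlt.le, by linarith [radius_pos (mid x q)]⟩
      refine notMem_interval_of_mem_stage this (2 * index x q + 1) ?_
      rw [← hm]
      exact mem_interval_self _

end ExceptionalSlopes

/-! ### Approximations with constant 1/3 and their consequences -/

namespace ExceptionalSlopes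
open Filter Topology

lemma tendsto_atTop_of_frequently_doubling {f : ℕ → ℕ} (hf : Monotone f) (h0 : ∀ n, 0 < f n)
    (h : ∀ N, ∃ n ≥ N, 2 * f n ≤ f (n + 1)) : Tendsto f atTop atTop := by
  refine tendsto_atTop_atTop_of_monotone hf fun B => ?_
  induction B with
  | zero => exact ⟨0, Nat.zero_le _⟩
  | succ B ih =>
    obtain ⟨N, hN⟩ := ih
    obtain ⟨n, hn, h2⟩ := h N
    have := hf hn
    have := h0 n
    exact ⟨n + 1, by omega⟩

lemma den_lower_monotone (x : ℝ) : Monotone fun q => (lower x q).den :=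
  monotone_nat_of_le_succ fun q => by
    have := (adjacent_lower_upper x q).two_mul_den_left_le
    by_cases h : x < mid x q
    · rw [lower_succ_of_lt h]
    · rw [lower_succ_of_not_lt h, mid]; omega

lemma den_upper_monotone (x : ℝ) : Monotone fun q => (upper x q).den :=
  monotone_nat_of_le_succ fun q => by
    have := (adjacent_lower_upper x q).two_mul_den_right_le
    by_cases h : x < mid x q
    · rw [upper_succ_of_lt h, mid]; omega
    · rw [upper_succ_of_not_lt h]

lemma tendsto_den_lower {x : ℝ} (h : ∀ N, ∃ q ≥ N, ¬ x < mid x q) :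
    Tendsto (fun q => (lower x q).den) atTop atTop := by
  refine tendsto_atTop_of_frequently_doubling (den_lower_monotone x) (fun q => Rat.den_pos _) ?_
  intro N
  obtain ⟨q, hq, hlt⟩ := h N
  refine ⟨q, hq, ?_⟩
  rw [lower_succ_of_not_lt hlt]
  exact (adjacent_lower_upper x q).two_mul_den_left_le

lemma tendsto_den_upper {x : ℝ} (h : ∀ N, ∃ q ≥ N, x < mid x q) :
    Tendsto (fun q => (upper x q).den) atTop atTop := by
  refine tendsto_atTop_of_frequently_doubling (den_upper_monotone x) (fun q => Rat.den_pos _) ?_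
  intro N
  obtain ⟨q, hq, hlt⟩ := h N
  refine ⟨q, hq, ?_⟩
  rw [upper_succ_of_lt hlt]
  exact (adjacent_lower_upper x q).two_mul_den_right_le

lemma tendsto_inv_sq {f : ℕ → ℕ} (hf : Tendsto f atTop atTop) :
    Tendsto (fun n => 1 / (f n : ℝ) ^ 2) atTop (𝓝 0) := by
  have h1 : Tendsto (fun n => (f n : ℝ)) atTop atTop := tendsto_natCast_atTop_atTop.comp hf
  have h2 := (tendsto_inv_atTop_zero.comp h1).pow 2
  simpa [Function.comp_def, inv_pow] using h2

lemma tendsto_upper_sub_lower {x : ℝ} (hl : ∀ N, ∃ q ≥ N, x < mid x q)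
    (hr : ∀ N, ∃ q ≥ N, ¬ x < mid x q) :
    Tendsto (fun q => (upper x q : ℝ) - lower x q) atTop (𝓝 0) := by
  have h := (tendsto_inv_sq (tendsto_den_lower hr)).add (tendsto_inv_sq (tendsto_den_upper hl))
  rw [add_zero] at h
  refine squeeze_zero (fun q => ?_) (fun q => ?_) h
  · have : (lower x q : ℝ) < upper x q := by exact_mod_cast (adjacent_lower_upper x q).lt
    linarith
  · have hadj := adjacent_lower_upper x q
    have key := congrArg (Rat.cast : ℚ → ℝ) hadj.sum_inv_sq
    push_cast at key
    have h1 : (lower x q : ℝ) < upper x q := by exact_mod_cast hadj.lt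
    have h2 : (upper x q : ℝ) - lower x q ≤ 1 := by exact_mod_cast hadj.sub_le_one
    rw [key]
    -- Since `d ≤ 1`, one has `d ≤ d(3 - d)`.
    nlinarith

lemma third_le_of_notMem_interval {x : ℝ} {α : ℚ} (h : x ∉ interval α) (hlt : (α : ℝ) < x) :
    1 / 3 ≤ (α.den : ℝ) ^ 2 * (x - α) := by
  have h1 := add_radius_le h hlt.le
  have hρ := radius_pos α
  have hr : (0 : ℝ) < α.den := by exact_mod_cast α.den_pos
  have h2 := radius_mul α
  have h3 : (α.den : ℝ) ^ 2 * (radius α * (3 - radius α)) = 1 := by rw [h2]; field_simp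
  have h4 : (α.den : ℝ) ^ 2 * radius α ≤ (α.den : ℝ) ^ 2 * (x - α) := by gcongr; linarith
  nlinarith [mul_pos (pow_pos hr 2) (pow_pos hρ 2)]

lemma le_of_lt_mid {x : ℝ} {q : ℕ} (h : x < mid x q) :
    ((lower x q).den : ℝ) ^ 2 * (x - lower x q) ≤ 1 / (3 - ((upper x q : ℝ) - lower x q)) := by
  have hadj := adjacent_lower_upper x q
  have hr : (0 : ℝ) < (lower x q).den := by exact_mod_cast (lower x q).den_pos
  have e := congrArg (Rat.cast : ℚ → ℝ) hadj.dot_eq_left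
  rw [← mid] at e
  push_cast at e
  have h3 : (0 : ℝ) < 3 - ((upper x q : ℝ) - lower x q) := by exact_mod_cast hadj.three_sub_pos
  have h4 : x - lower x q ≤
      1 / (((lower x q).den : ℝ) ^ 2 * (3 - ((upper x q : ℝ) - lower x q))) := by linarith
  calc _ ≤ ((lower x q).den : ℝ) ^ 2 *
        (1 / (((lower x q).den : ℝ) ^ 2 * (3 - ((upper x q : ℝ) - lower x q)))) := by gcongr
    _ = _ := by field_simp

/-- Both letters occur infinitely often. -/
lemma frequently_of_not_eventually_const {x : ℝ} (hx : x ∈ Set.Ioo (0 : ℝ) 1)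
    (hC : x ∈ cantorSet) (hσ : ¬ ∃ c : Letter, ∃ N : ℕ, ∀ n ≥ N, leftRightSeq x n = c) :
    (∀ N, ∃ q ≥ N, x < mid x q) ∧ ∀ N, ∃ q ≥ N, ¬ x < mid x q := by
  constructor <;> intro N <;> by_contra! hN
  -- Letter `m + 1` is decided by `mid x m`; letter 0 compares `x` with the slope 0 and is skipped.
  · refine hσ ⟨Letter.R, N + 1, fun n hn => ?_⟩
    obtain ⟨m, rfl⟩ := Nat.exists_eq_add_of_le' (Nat.one_le_of_lt hn)
    exact if_neg fun h => (hN m (by omega)).not_gt ((inLeftPart_iff hx hC m).mp h)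
  · refine hσ ⟨Letter.L, N + 1, fun n hn => ?_⟩
    obtain ⟨m, rfl⟩ := Nat.exists_eq_add_of_le' (Nat.one_le_of_lt hn)
    exact if_pos ((inLeftPart_iff hx hC m).mpr (hN m (by omega)))

/-- There are rational numbers `p / r` with `r → ∞` and `r² (x - p / r) → 1 / 3`. -/
lemma exists_approximations {x : ℝ} (hx : x ∈ Set.Ioo (0 : ℝ) 1)
    (hC : x ∈ cantorSet) (hσ : ¬ ∃ c : Letter, ∃ N : ℕ, ∀ n ≥ N, leftRightSeq x n = c) :
    ∃ α : ℕ → ℚ, Tendsto (fun n => (α n).den) atTop atTop ∧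
      Tendsto (fun n => ((α n).den : ℝ) ^ 2 * (x - α n)) atTop (𝓝 (1 / 3)) := by
  obtain ⟨hl, hr⟩ := frequently_of_not_eventually_const hx hC hσ
  -- The lower bound `1/3` holds at every level, the upper bound only where the letter is `L`.
  obtain ⟨φ, hφ, hφl⟩ := extraction_of_frequently_atTop (frequently_atTop.mpr hl)
  refine ⟨fun n => lower x (φ n), (tendsto_den_lower hr).comp hφ.tendsto_atTop, ?_⟩
  have hd := (tendsto_upper_sub_lower hl hr).comp hφ.tendsto_atTop
  have hu : Tendsto (fun n => 1 / (3 - ((upper x (φ n) : ℝ) - lower x (φ n)))) atTop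
      (𝓝 (1 / 3)) := by
    have := (tendsto_const_nhds (x := (1 : ℝ))).div
      ((tendsto_const_nhds (x := (3 : ℝ))).sub hd) (by norm_num)
    rw [sub_zero] at this
    exact this
  refine tendsto_of_tendsto_of_tendsto_of_le_of_le tendsto_const_nhds hu (fun n => ?_)
    fun n => le_of_lt_mid (hφl n)
  exact third_le_of_notMem_interval
    (notMem_interval_of_mem_cantorSet hC (eps_mem_slopes _ _)) (lower_lt_and_lt_upper hx hC _).1

/-- If `x` had denominator `s`, then `s r (x - α)` would be an integer, eventually positive, and
tending to 0 because `r²(x - α)` is bounded. -/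
lemma irrational_of_approximations {x : ℝ} {α : ℕ → ℚ}
    (hden : Tendsto (fun n => (α n).den) atTop atTop)
    (hlim : Tendsto (fun n => ((α n).den : ℝ) ^ 2 * (x - α n)) atTop (𝓝 (1 / 3))) :
    Irrational x := by
  rintro ⟨y, rfl⟩
  have hinv : Tendsto (fun n => ((α n).den : ℝ)⁻¹) atTop (𝓝 0) :=
    tendsto_inv_atTop_zero.comp (tendsto_natCast_atTop_atTop.comp hden)
  have h := (hlim.mul hinv).const_mul (y.den : ℝ)
  rw [mul_zero, mul_zero] at h
  have hev : ∀ᶠ n in atTop, 0 < ((α n).den : ℝ) ^ 2 * ((y : ℝ) - α n) :=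
    hlim.eventually (lt_mem_nhds (by norm_num))
  obtain ⟨n, h1, h2⟩ := ((h.eventually (gt_mem_nhds one_pos)).and hev).exists
  have hr : (0 : ℝ) < (α n).den := by exact_mod_cast (α n).den_pos
  have hs : (0 : ℝ) < y.den := by exact_mod_cast y.den_pos
  have e : (y.den : ℝ) * (((α n).den : ℝ) ^ 2 * ((y : ℝ) - α n) * ((α n).den : ℝ)⁻¹) =
      ((y.num * (α n).den - (α n).num * y.den : ℤ) : ℝ) := by
    rw [Rat.cast_def y, Rat.cast_def (α n)]
    push_cast
    field_simp
  have h3 : 0 < (y.den : ℝ) * (((α n).den : ℝ) ^ 2 * ((y : ℝ) - α n) * ((α n).den : ℝ)⁻¹) := by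
    positivity
  rw [e] at h1 h3
  have h1' : y.num * (α n).den - (α n).num * y.den < 1 := by exact_mod_cast h1
  have h3' : 0 < y.num * (α n).den - (α n).num * y.den := by exact_mod_cast h3
  omega

lemma not_isQuadraticIrrational_of_approximations {x : ℝ} {α : ℕ → ℚ}
    (hden : Tendsto (fun n => (α n).den) atTop atTop)
    (hlim : Tendsto (fun n => ((α n).den : ℝ) ^ 2 * (x - α n)) atTop (𝓝 (1 / 3))) :
    ¬ IsQuadraticIrrational x := by
  rintro ⟨hx, a, b, c, ha, h⟩
  set u : ℕ → ℝ := fun n => ((α n).den : ℝ) ^ 2 * (x - α n) with hu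
  -- Taylor expansion of `r² f(α)` at the root `x` of `f = aX² + bX + c`, where `α = x - u/r²`.
  have hT : Tendsto (fun n => -(u n * (2 * a * x + b)) + a * (u n ^ 2 * (1 / ((α n).den : ℝ) ^ 2)))
      atTop (𝓝 (-(1 / 3 * (2 * a * x + b)) + a * ((1 / 3) ^ 2 * 0))) :=
    (hlim.mul_const _).neg.add (((hlim.pow 2).mul (tendsto_inv_sq hden)).const_mul _)
  have hmem := Int.isClosedEmbedding_coe_real.isClosed_range.mem_of_tendsto hT
    (Eventually.of_forall fun n => by
      refine ⟨a * (α n).num ^ 2 + b * (α n).num * (α n).den + c * (α n).den ^ 2, ?_⟩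
      have hr : (0 : ℝ) < (α n).den := by exact_mod_cast (α n).den_pos
      have hnum : ((α n).num : ℝ) = (α n : ℝ) * (α n).den := by
        rw [Rat.cast_def (α n)]; field_simp
      have e : u n ^ 2 * (1 / ((α n).den : ℝ) ^ 2) = ((α n).den : ℝ) ^ 2 * (x - α n) ^ 2 := by
        rw [hu]; field_simp
      rw [e]
      push_cast
      rw [hnum, hu]
      linear_combination ((α n).den : ℝ) ^ 2 * h)
  obtain ⟨N, hN⟩ := hmem
  have ha' : (a : ℝ) ≠ 0 := by exact_mod_cast ha
  -- The solution of `-(2ax + b)/3 = N`, where the limit `N` is an integer because `ℤ` is closed in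
  -- `ℝ`.
  refine hx ⟨(-3 * N - b) / (2 * a), ?_⟩
  push_cast
  rw [div_eq_iff (by positivity)]
  linear_combination -3 * hN

end ExceptionalSlopes

theorem mainTheorem4 (x : ℝ)
    (hxC : x ∈ ExceptionalSlopes.cantorSet)
    (hx : x ∈ Set.Ioo (0 : ℝ) (1 / 2))
    (hσ : ¬ ∃ c : ExceptionalSlopes.Letter, ∃ N : ℕ,
      ∀ n ≥ N, ExceptionalSlopes.leftRightSeq x n = c) :
    ¬ ExceptionalSlopes.EventuallyPeriodic (ExceptionalSlopes.partialQuotients x) ∧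
      ¬ ExceptionalSlopes.IsQuadraticIrrational x := by
  obtain ⟨α, hden, hlim⟩ :=
    ExceptionalSlopes.exists_approximations ⟨hx.1, by linarith [hx.2]⟩ hxC hσ
  have hq := ExceptionalSlopes.not_isQuadraticIrrational_of_approximations hden hlim
  -- A finite continued fraction is eventually `none`, hence eventually periodic, so the first claim
  -- also says that the expansion is infinite.
  exact ⟨fun h => hq (ExceptionalSlopes.isQuadraticIrrational_of_eventuallyPeriodic
    (ExceptionalSlopes.irrational_of_approximations hden hlim) h), hq⟩
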